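/- Let $\Gamma$ be a finite extensive-form game with perfect recall, with finite player set $N$ and a chance player $c$ (put $N_c=N\cup\{c\}$), histories $H$, terminal histories $Z$, payoffs $u_z^i:Z\to\mathbb{R}$, and information sets $I$ of player $i$ with action sets $A(I)$ (actions at different information sets are regarded as different). Chance moves are drawn independently at the chance nodes. *Reduced normal form.* A (reduced) pure strategy $s^i\in S^i$ of $i\in N_c$ is a partial function that assigns actions $s^i(I)\in A(I)$ to exactly those information sets $I$ of $i$ that are not excluded by $i$'s own earlier choices under $s^i$. For $i\in N$ let $\Xi^i$ be the simplex of mixed strategies on $S^i$, and $\Xi=\prod_{i\in N}\Xi^i$. Chance plays the fixed mixed strategy $\sigma^c$ under which $s^c$ has as its probability the product of the probabilities of all actions it prescribes. Let $u^i(s^i,\sigma^{-i})$ be the expected payoff of $i$ when $i$ plays $s^i$ and all others (including chance) play $\sigma^{-i}$. For $\varepsilon>0$, a totally mixed $\sigma\in\Xi$ is an $\varepsilon$-normal-form perfect equilibrium if $\sigma^i(s^i)\le\varepsilon$ whenever $u^i(s^i,\sigma^{-i})<u^i(\tilde s^i,\sigma^{-i})$ for some $\tilde s^i\in S^i$. A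 profile $\sigma^*\in\Xi$ is a normal-form perfect equilibrium if it is a limit point of some sequence $(\sigma_k)$ in which each $\sigma_k$ is an $\varepsilon_k$-normal-form perfect equilibrium and $\varepsilon_k\to0$. *Sequence form.* For $h\in H$ let $w^i_h$ be the set of actions that $i\in N_c$ takes along $h$, let $W^i=\{w^i_h:h\in H\}$, and for an information set $I$ of $i$ let $w^i_I=w^i_h$ for $h\in I$, and $w^i_Ia=w^i_I\cup\{a\}$. Let $\Lambda^i$ be the set of realization plans of $i\in N$: the $\gamma^i:W^i\to\mathbb{R}$ with $\gamma^i(\emptyset)=1$, $\sum_{a\in A(I)}\gamma^i(w^i_Ia)=\gamma^i(w^i_I)$ and $\gamma^i(w^i_Ia)\ge0$ for all $I$ and $a\in A(I)$. Put $\Lambda=\prod_{i\in N}\Lambda^i$; its interior consists of the strictly positive profiles. The realization plan $\gamma^c(w^c)$ of chance is the product of the probabilities of the actions in $w^c$. Let $g^i(w)=u^i_z(h)$ if $w=(w^q_h)_{q\in N_c}$ for some $h\in Z$, and $g^i(w)=0$ otherwise, and let $g^i(w^i,\gamma^{-i})=\sum_{w^{-i}}g^i(w^i,w^{-i})\prod_{q\in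 N_c\setminus\{i\}}\gamma^q(w^q)$. For an interior $\gamma\in\Lambda$ let $\sigma(\gamma)\in\Xi$ be the totally mixed profile $$\sigma^i(\gamma;s^i)=\prod_{(I,a):\,s^i(I)=a}\frac{\gamma^i(w^i_Ia)}{\gamma^i(w^i_I)} .$$ *The artificial game.* Fix a prior $p^0\in\Lambda$ and put $y(\gamma,t)=(1-t)\gamma+tp^0$ for $\gamma\in\Lambda$, $t\in[0,1]$. For $t\in(0,1]$, a profile $\gamma\in\Lambda$ is a Nash equilibrium of $\Gamma^v_s(t)$ if, for each $i\in N$, $\gamma^i$ maximizes $$\sum_{I}\sum_{a\in A(I)}\tilde\gamma^i(w^i_Ia)\,g^i\bigl(w^i_Ia,\,y(\gamma,t)^{-i}\bigr)$$ over the functions $\tilde\gamma^i$ on $W^i$ with $\tilde\gamma^i(\emptyset)=1$, $\sum_{a\in A(I)}\tilde\gamma^i(w^i_Ia)=\tilde\gamma^i(w^i_I)$ for all information sets $I$ of $i$, and $\tilde\gamma^i(w^i_Ia)\ge0$ for all $(I,a)$ such that $w^i_Ia=w^i_J$ for no information set $J$ of $i$ (that is, over $\Lambda^i$). **Theorem.**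 Let $t_k\in(0,1]$ with $t_k\to0$, and let $\gamma^{*k}$ be a Nash equilibrium of $\Gamma^v_s(t_k)$ for each $k$. Suppose that each $y(\gamma^{*k},t_k)$ is in the interior of $\Lambda$, so that $\sigma(y(\gamma^{*k},t_k))$ is defined (this is automatic if $p^0$ is strictly positive). Then every limit point of the sequence $\bigl(\sigma(y(\gamma^{*k},t_k))\bigr)_k$ is a normal-form perfect equilibrium of $\Gamma$. -/

import Mathlib

open Filter Topology

noncomputable section

namespace SeqForm

universe u v

section Game

variable {N : Type u} {A : Type v}

open scoped Classical in
/-- The set `A(h)` of actions available after the history `h`, when `H` is the set of histories. -/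
def actionsAfter (H : Finset (List A)) (h : List A) : Finset A :=
  (H.biUnion fun k => k.toFinset).filter fun a => h ++ [a] ∈ H

open scoped Classical in
/-- The non-terminal histories after which `i` moves (`none` is the chance player). -/
def decisionNodes (H : Finset (List A)) (P : List A → Option N) (i : Option N) :
    Finset (List A) :=
  H.filter fun h => (actionsAfter H h).Nonempty ∧ P h = i

open scoped Classical in
/-- A finite extensive-form game. `N` is the set of (personal) players, and `Option N` is the set of
players together with the chance player `none`. A history is the list of the actions taken so far.
The values of `P`, `fc`, `payoff` are only used at non-terminal histories, at chance nodes, and at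
terminal histories, respectively. -/
structure ExtensiveGame (N : Type u) (A : Type v) where
  /-- the finite set of histories -/
  H : Finset (List A)
  nil_mem : [] ∈ H
  prefix_mem : ∀ (h : List A) (a : A), h ++ [a] ∈ H → h ∈ H
  /-- the player who moves after a non-terminal history -/
  P : List A → Option N
  /-- `fc h a` is the probability that chance takes the action `a` after the history `h` -/
  fc : List A → A → ℝ
  fc_nonneg : ∀ h ∈ decisionNodes H P none, ∀ a ∈ actionsAfter H h, 0 ≤ fc h a
  fc_sum : ∀ h ∈ decisionNodes H P none, ∑ a ∈ actionsAfter H h, fc h a = 1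
  /-- the information partitions; its parts are the information sets -/
  info : ∀ i : Option N, Finpartition (decisionNodes H P i)
  info_actions : ∀ i, ∀ I ∈ (info i).parts, ∀ h ∈ I, ∀ h' ∈ I, actionsAfter H h = actionsAfter H h'
  /-- chance moves are drawn separately at each chance node -/
  info_chance : ∀ I ∈ (info none).parts, ∃ h, I = {h}
  /-- the payoff of a player at a terminal history -/
  payoff : N → List A → ℝ

/-- An action together with the information set at which it is taken, so that actions at different
information sets are different objects. -/
abbrev Move (A : Type v) : Type v := Finset (List A) × A

namespace ExtensiveGame

variable (G : ExtensiveGame N A)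

/-- The actions available after a history. -/
def act (h : List A) : Finset A := actionsAfter G.H h

open scoped Classical in
/-- The terminal histories. -/
def Z : Finset (List A) := G.H.filter fun h => G.act h = ∅

open scoped Classical in
/-- The information sets of `i`. -/
def infoSets (i : Option N) : Finset (Finset (List A)) := (G.info i).parts

open scoped Classical in
/-- The information set to which a non-terminal history belongs. -/
def infoOf (h : List A) : Finset (List A) := (G.info (G.P h)).part h

open scoped Classical in
/-- `A(I)`, which is `A(h)` for each `h ∈ I`. -/
def actInfo (I : Finset (List A)) : Finset A := I.biUnion G.act

/-- The `q`-th move along the history `h`. -/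
def moveAt (h : List A) (q : Fin h.length) : Move A := (G.infoOf (h.take q), h.get q)

open scoped Classical in
/-- The record of the experience of `i` along `h`: the list of the information sets that `i`
encounters along `h` and of the actions that `i` takes there, in the order of play. -/
def experience (i : Option N) (h : List A) : List (Move A) :=
  ((List.finRange h.length).filter fun q : Fin h.length => G.P (h.take q) = i).map (G.moveAt h)

/-- Perfect recall. -/
def PerfectRecall : Prop :=
  ∀ i : N, ∀ I ∈ G.infoSets (some i), ∀ h ∈ I, ∀ h' ∈ I,
    G.experience (some i) h = G.experience (some i) h'

open scoped Classical in
/-- The sequence `w^i_h`: the set of actions that `i` takes along `h`. -/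
def seqOf (i : Option N) (h : List A) : Finset (Move A) := (G.experience i h).toFinset

open scoped Classical in
/-- The set `W^i` of sequences of `i`. -/
def seqs (i : Option N) : Finset (Finset (Move A)) := G.H.image (G.seqOf i)

open scoped Classical in
/-- The sequence `w^i_I` leading to the information set `I` of `i`; under perfect recall, it is
`w^i_h` for each `h ∈ I`. -/
def seqInfo (i : Option N) (I : Finset (List A)) : Finset (Move A) := I.biUnion (G.seqOf i)

open scoped Classical in
/-- The extended sequence `w^i_I a`. -/
def seqExt (i : Option N) (I : Finset (List A)) (a : A) : Finset (Move A) :=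
  insert (I, a) (G.seqInfo i I)

/-! ### The (reduced) normal form -/

open scoped Classical in
/-- All the moves of `i`. -/
def moves (i : Option N) : Finset (Move A) :=
  (G.infoSets i).biUnion fun I => (G.actInfo I).image fun a => (I, a)

open scoped Classical in
/-- The reduced pure strategies of `i`. Such a strategy is a partial function `s` from the
information sets `I` of `i` to the actions in `A(I)`, given here by its graph (the set of all `(I, a)`
with `s(I) = a`); it is defined at precisely those `I` that the earlier choices of `s` do not
exclude, i.e. those for which `s` prescribes each of the moves in `w^i_I`. -/
def pureStrategies (i : Option N) : Finset (Finset (Move A)) :=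
  (G.moves i).powerset.filter fun s =>
    ∀ I ∈ G.infoSets i,
      (G.seqInfo i I ⊆ s → ∃! a : A, (I, a) ∈ s) ∧
      (∀ a : A, (I, a) ∈ s → G.seqInfo i I ⊆ s)

/-- The type `S^i` of reduced pure strategies of `i`. -/
abbrev PureStrategy (i : Option N) : Type v := {s : Finset (Move A) // s ∈ G.pureStrategies i}

/-- Families of real numbers `σ^i(s^i)`, `i ∈ N`, `s^i ∈ S^i`. -/
abbrev Mixed : Type (max u v) := ∀ i : N, G.PureStrategy (some i) → ℝ

/-- The set `Ξ` of mixed strategy profiles. -/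
def IsMixed (σ : G.Mixed) : Prop :=
  ∀ i, (∀ s, 0 ≤ σ i s) ∧ ∑ s, σ i s = 1

/-- The set `int Ξ` of totally mixed strategy profiles. -/
def IsTotallyMixed (σ : G.Mixed) : Prop :=
  G.IsMixed σ ∧ ∀ i s, 0 < σ i s

open scoped Classical in
/-- The fixed mixed strategy `σ^c` of chance: the product, over the chance nodes at which `s^c`
prescribes an action, of the probability of that action. -/
def chanceMixed (s : G.PureStrategy none) : ℝ :=
  ∏ h ∈ decisionNodes G.H G.P none with G.seqOf none h ⊆ s.1,
    ∑ a ∈ G.act h, if (G.infoOf h, a) ∈ s.1 then G.fc h a else 0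

/-- A mixed strategy profile, completed by the strategy of chance. -/
def withChanceMixed (σ : G.Mixed) : ∀ q : Option N, G.PureStrategy q → ℝ
  | none => G.chanceMixed
  | some i => σ i

open scoped Classical in
/-- The payoff `u^i(s)` under a profile of pure strategies of all the players and chance. -/
def purePayoff (i : N) (s : ∀ q : Option N, G.PureStrategy q) : ℝ :=
  ∑ h ∈ G.Z, G.payoff i h *
    ∏ q : Fin h.length, if G.moveAt h q ∈ (s (G.P (h.take q))).1 then 1 else 0

open scoped Classical in
/-- The expected payoff `u^i(s^i, σ^{-i})`. -/
def normalPayoff [Fintype N] (i : N) (si : G.PureStrategy (some i)) (σ : G.Mixed) : ℝ :=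
  ∑ s : (∀ q : Option N, G.PureStrategy q) with s (some i) = si,
    G.purePayoff i s * ∏ q ∈ Finset.univ.erase (some i), G.withChanceMixed σ q (s q)

/-- `ε`-normal-form perfect equilibria. -/
def IsEpsNormalFormPerfect [Fintype N] (ε : ℝ) (σ : G.Mixed) : Prop :=
  0 < ε ∧ G.IsTotallyMixed σ ∧
    ∀ (i : N) (s s' : G.PureStrategy (some i)), G.normalPayoff i s σ < G.normalPayoff i s' σ → σ i s ≤ ε

/-- Normal-form perfect equilibria: the limit points of sequences of `ε^k`-normal-form perfect
equilibria with `ε^k → 0`. -/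
def IsNormalFormPerfect [Fintype N] (σ : G.Mixed) : Prop :=
  G.IsMixed σ ∧ ∃ (ε : ℕ → ℝ) (τ : ℕ → G.Mixed),
    Tendsto ε atTop (𝓝 0) ∧ (∀ k, G.IsEpsNormalFormPerfect (ε k) (τ k)) ∧ MapClusterPt σ atTop τ

/-! ### The sequence form -/

end ExtensiveGame

/-- Families of real numbers `γ^i(w^i)`, `i ∈ N`; only the values at the sequences `w^i ∈ W^i` are
ever used. -/
abbrev Plans (N : Type u) (A : Type v) : Type (max u v) := N → Finset (Move A) → ℝ

namespace ExtensiveGame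

variable (G : ExtensiveGame N A)

/-- The linear equations of a realization plan of `i`. -/
def FlowEquations (i : Option N) (γ : Finset (Move A) → ℝ) : Prop :=
  γ ∅ = 1 ∧
    ∀ I ∈ G.infoSets i, ∑ a ∈ G.actInfo I, γ (G.seqExt i I a) = γ (G.seqInfo i I)

/-- The set `Λ^i` of realization plans of `i`. -/
def IsPlan (i : Option N) (γ : Finset (Move A) → ℝ) : Prop :=
  G.FlowEquations i γ ∧ ∀ I ∈ G.infoSets i, ∀ a ∈ G.actInfo I, 0 ≤ γ (G.seqExt i I a)

/-- The set `Λ` of realization plan profiles. -/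
def IsPlanProfile (γ : Plans N A) : Prop := ∀ i : N, G.IsPlan (some i) (γ i)

/-- The (relative) interior of `Λ`: the positive realization plan profiles. -/
def IsInteriorPlanProfile (γ : Plans N A) : Prop :=
  G.IsPlanProfile γ ∧ ∀ i : N, ∀ w ∈ G.seqs (some i), 0 < γ i w

open scoped Classical in
/-- The realization plan `γ^c` of chance. -/
def chancePlan (w : Finset (Move A)) : ℝ :=
  ∏ h ∈ decisionNodes G.H G.P none, ∏ a ∈ G.act h,
    if (G.infoOf h, a) ∈ w then G.fc h a else 1

/-- A realization plan profile, completed by the plan of chance. -/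
def withChancePlan (γ : Plans N A) : Option N → Finset (Move A) → ℝ
  | none => G.chancePlan
  | some i => γ i

open scoped Classical in
/-- The payoff `g^i(w)` of a sequence profile: `u^i_z(h)` if `w` is defined by the terminal history
`h`, and zero if there is no such `h`. (Under perfect recall, there is at most one such `h`.) -/
def seqPayoff (i : N) (w : Option N → Finset (Move A)) : ℝ :=
  ∑ h ∈ G.Z, if w = (fun q => G.seqOf q h) then G.payoff i h else 0

open scoped Classical in
/-- The expected payoff `g^i(w^i, γ^{-i})` at the sequence `w^i`. -/
def seqExpected [Fintype N] (i : N) (wi : Finset (Move A)) (γ : Plans N A) : ℝ :=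
  ∑ w ∈ Fintype.piFinset G.seqs with w (some i) = wi,
    G.seqPayoff i w * ∏ q ∈ Finset.univ.erase (some i), G.withChancePlan γ q (w q)

/-- The objective `∑_{j, a} γ^i(w^i_{I_j} a) g^i(w^i_{I_j} a, y^{-i})`. -/
def objective [Fintype N] (i : N) (γi : Finset (Move A) → ℝ) (y : Plans N A) : ℝ :=
  ∑ I ∈ G.infoSets (some i), ∑ a ∈ G.actInfo I,
    γi (G.seqExt (some i) I a) * G.seqExpected i (G.seqExt (some i) I a) y

/-- The set `D_i`: the pairs `(I, a)` such that `w^i_I a` leads to no information set of `i`. -/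
def IsLast (i : Option N) (I : Finset (List A)) (a : A) : Prop :=
  ∀ J ∈ G.infoSets i, G.seqInfo i J ≠ G.seqExt i I a

/-- The constraints of the optimization problem of `i`. -/
def IsFeasible (i : N) (γi : Finset (Move A) → ℝ) : Prop :=
  G.FlowEquations (some i) γi ∧
    ∀ I ∈ G.infoSets (some i), ∀ a ∈ G.actInfo I, G.IsLast (some i) I a →
      0 ≤ γi (G.seqExt (some i) I a)

end ExtensiveGame

/-- `y(γ, t) = (1 - t) γ + t p⁰`. -/
def mixWithPrior (p0 γ : Plans N A) (t : ℝ) : Plans N A :=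
  fun i w => (1 - t) * γ i w + t * p0 i w

namespace ExtensiveGame

variable (G : ExtensiveGame N A)

/-- `γ` is a Nash equilibrium of the artificial game with prior `p⁰` and parameter `t`: it is a
realization plan profile each component of which solves the optimization problem of the respective
player against `y(γ, t)`. -/
def IsArtificialNash [Fintype N] (p0 : Plans N A) (t : ℝ) (γ : Plans N A) : Prop :=
  G.IsPlanProfile γ ∧ ∀ i : N, G.IsFeasible i (γ i) ∧
    ∀ γ' : Finset (Move A) → ℝ, G.IsFeasible i γ' →
      G.objective i γ' (mixWithPrior p0 γ t) ≤ G.objective i (γ i) (mixWithPrior p0 γ t)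

/-- The mixed strategy profile `σ(γ)` of an interior realization plan profile `γ`:
`σ^i(γ; s^i)` is the product of `γ^i(w^i_I a) / γ^i(w^i_I)` over all `I`, `a` with `s^i(I) = a`. -/
def toMixed (γ : Plans N A) : G.Mixed :=
  fun i s => ∏ m ∈ s.1, γ i (G.seqExt (some i) m.1 m.2) / γ i (G.seqInfo (some i) m.1)

end ExtensiveGame

end Game

end SeqForm

end

/-!
Every profile `σ(y(γ*, t))` is itself a `t`-normal-form perfect equilibrium, so the sequence in the
theorem witnesses the normal-form perfection of each of its limit points.

Realization equivalence (`PerfectRecall.sum_withChanceMixed`): if `y` is interior, then under `σ(y)`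
the reduced pure strategies of a player that prescribe all the moves of a sequence `w` have total
probability `y(w)`, and likewise for chance. This rests on the identity
`sum_prod_reducedStrategies`, by which the products of local probabilities over the reduced pure
strategies add up to one; it is proved by removing the information sets one by one, the latest ones
first. Consequently, up to a term that does not depend on the player's own strategy `s`, the payoff
of `s` against `σ(y)` is the sequence-form objective at the indicator plan `purePlan s`
(`PerfectRecall.normalPayoff_sub`).

Suppose now that `s` is a worse reply than `s'` against `σ(y)`, where `y = (1 - t) γ* + t p⁰`. If `γ*`
were positive at all the extended sequences `w_I a` with `s(I) = a`, then
`γ* + c (purePlan s' - purePlan s)` would be a realization plan for a small `c > 0`, with a larger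
objective than the maximizer `γ*`. So `γ*` vanishes at one such sequence `w_I a`
(`exists_move_eq_zero`), whence `y(w_I a) = t p⁰(w_I a) ≤ t`; and the probability of `s` under `σ(y)`
is at most `y(w_I a)`, since `s` prescribes all the moves of `w_I a`.
-/

noncomputable section

namespace SeqForm

universe u v

open scoped Classical

/-! ### Products of local probabilities over reduced strategies -/

section Kuhn

variable {ι : Type u} {α : Type v}

/-- The graphs `s` of the reduced strategies on the finite set `𝓘` of information sets, where `act I`
are the actions at `I` and `pred I` are the own moves that lead to `I`: such an `s` is defined at
exactly those `I ∈ 𝓘` for which it contains `pred I`. No tree structure on `pred` is required. -/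
def reducedStrategies (act : ι → Finset α) (pred : ι → Finset (ι × α)) (𝓘 : Finset ι) :
    Finset (Finset (ι × α)) :=
  (𝓘.biUnion fun I => (act I).image fun a => (I, a)).powerset.filter fun s =>
    ∀ I ∈ 𝓘, (pred I ⊆ s → ∃! a : α, (I, a) ∈ s) ∧ (∀ a : α, (I, a) ∈ s → pred I ⊆ s)

variable {act : ι → Finset α} {pred : ι → Finset (ι × α)} {𝓘 : Finset ι}

lemma mem_reducedStrategies {s : Finset (ι × α)} :
    s ∈ reducedStrategies act pred 𝓘 ↔ (∀ m ∈ s, m.1 ∈ 𝓘 ∧ m.2 ∈ act m.1) ∧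
      ∀ I ∈ 𝓘, (pred I ⊆ s → ∃! a : α, (I, a) ∈ s) ∧ (∀ a : α, (I, a) ∈ s → pred I ⊆ s) := by
  simp only [reducedStrategies, Finset.mem_filter, Finset.mem_powerset]
  refine and_congr_left fun _ => ⟨fun h m hm => ?_, fun h m hm => ?_⟩
  · obtain ⟨I, hI, hm'⟩ := Finset.mem_biUnion.1 (h hm)
    obtain ⟨a, ha, rfl⟩ := Finset.mem_image.1 hm'
    exact ⟨hI, ha⟩
  · exact Finset.mem_biUnion.2 ⟨m.1, (h m hm).1, Finset.mem_image.2 ⟨m.2, (h m hm).2, rfl⟩⟩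

lemma filter_mem_reducedStrategies {I : ι} (hI : I ∉ 𝓘)
    (hpred : ∀ J ∈ insert I 𝓘, ∀ m ∈ pred J, m.1 ≠ I) {s : Finset (ι × α)}
    (hs : s ∈ reducedStrategies act pred (insert I 𝓘)) :
    s.filter (fun m => m.1 ≠ I) ∈ reducedStrategies act pred 𝓘 := by
  rw [mem_reducedStrategies] at hs ⊢
  have hsub : ∀ J ∈ insert I 𝓘, (pred J ⊆ s.filter (fun m => m.1 ≠ I) ↔ pred J ⊆ s) :=
    fun J hJ => ⟨fun h => h.trans (Finset.filter_subset _ _),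
      fun h m hm => Finset.mem_filter.2 ⟨h hm, hpred J hJ m hm⟩⟩
  refine ⟨fun m hm => ?_, fun J hJ => ?_⟩
  · rw [Finset.mem_filter] at hm
    exact ⟨Finset.mem_of_mem_insert_of_ne (hs.1 m hm.1).1 hm.2, (hs.1 m hm.1).2⟩
  · have hne : J ≠ I := fun h => hI (h ▸ hJ)
    have hJ' := Finset.mem_insert_of_mem (b := I) hJ
    simpa [hsub J hJ', hne] using hs.2 J hJ'

lemma insert_mem_reducedStrategies {I : ι} (hI : I ∉ 𝓘)
    (hpred : ∀ J ∈ insert I 𝓘, ∀ m ∈ pred J, m.1 ≠ I) {s : Finset (ι × α)}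
    (hs : s ∈ reducedStrategies act pred 𝓘) {a : α} (ha : a ∈ act I) (hIs : pred I ⊆ s) :
    insert (I, a) s ∈ reducedStrategies act pred (insert I 𝓘) := by
  rw [mem_reducedStrategies] at hs ⊢
  have hsub : ∀ J ∈ insert I 𝓘, (pred J ⊆ insert (I, a) s ↔ pred J ⊆ s) :=
    fun J hJ => ⟨fun h m hm => Finset.mem_of_mem_insert_of_ne (h hm)
        (fun h' => hpred J hJ m hm (by rw [h'])),
      fun h => h.trans (Finset.subset_insert _ _)⟩
  refine ⟨fun m hm => ?_, fun J hJ => ?_⟩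
  · rcases Finset.mem_insert.1 hm with rfl | hm
    · exact ⟨Finset.mem_insert_self _ _, ha⟩
    · exact ⟨Finset.mem_insert_of_mem (hs.1 m hm).1, (hs.1 m hm).2⟩
  · rw [hsub J hJ]
    rcases Finset.mem_insert.1 hJ with rfl | hJ'
    · refine ⟨fun _ => ⟨a, Finset.mem_insert_self _ _, fun b hb => ?_⟩, fun _ _ => hIs⟩
      rcases Finset.mem_insert.1 hb with h | h
      · exact (Prod.ext_iff.1 h).2
      · exact absurd (hs.1 _ h).1 hI
    · have hne : J ≠ I := fun h => hI (h ▸ hJ')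
      simpa [hne] using hs.2 J hJ'

lemma mem_reducedStrategies_insert_of_not_subset {I : ι} (hI : I ∉ 𝓘) {s : Finset (ι × α)}
    (hs : s ∈ reducedStrategies act pred 𝓘) (hIs : ¬ pred I ⊆ s) :
    s ∈ reducedStrategies act pred (insert I 𝓘) := by
  rw [mem_reducedStrategies] at hs ⊢
  refine ⟨fun m hm => ⟨Finset.mem_insert_of_mem (hs.1 m hm).1, (hs.1 m hm).2⟩, fun J hJ => ?_⟩
  rcases Finset.mem_insert.1 hJ with rfl | hJ'
  · exact ⟨fun h => absurd h hIs, fun a ha => absurd (hs.1 _ ha).1 hI⟩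
  · exact hs.2 J hJ'

/-- If the moves in `pred I` belong to information sets of lower rank than `I`, then the products of
the local probabilities `β` over the reduced strategies add up to one. Removing an information set
`I` of maximal rank merges the strategies that differ at `I` only, and these carry the local
probabilities at `I` as factors. -/
theorem sum_prod_reducedStrategies (rank : ι → ℕ) (β : ι × α → ℝ)
    (hrank : ∀ I ∈ 𝓘, ∀ m ∈ pred I, rank m.1 < rank I)
    (hβ : ∀ I ∈ 𝓘, ∑ a ∈ act I, β (I, a) = 1) :
    ∑ s ∈ reducedStrategies act pred 𝓘, ∏ m ∈ s, β m = 1 := by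
  induction 𝓘 using Finset.induction_on_max_value rank with
  | empty =>
    have : reducedStrategies act pred (∅ : Finset ι) = {∅} := by
      ext s; simp [reducedStrategies]
    simp [this]
  | insert I 𝓘 hI hmax ih =>
    specialize ih (fun J hJ => hrank J (Finset.mem_insert_of_mem hJ))
      (fun J hJ => hβ J (Finset.mem_insert_of_mem hJ))
    have hpred : ∀ J ∈ insert I 𝓘, ∀ m ∈ pred J, m.1 ≠ I := by
      rintro J hJ m hm rfl
      have h1 := hrank J hJ m hm
      rcases Finset.mem_insert.1 hJ with rfl | hJ
      · exact lt_irrefl _ h1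
      · exact absurd (hmax J hJ) (not_le.2 h1)
    rw [← Finset.sum_fiberwise_of_maps_to
      (fun s hs => filter_mem_reducedStrategies hI hpred hs), ← ih]
    refine Finset.sum_congr rfl fun s hs => ?_
    have hsI : ∀ m ∈ s, m.1 ≠ I := fun m hm h =>
      hI (h ▸ ((mem_reducedStrategies.1 hs).1 m hm).1)
    have hfs : s.filter (fun m => m.1 ≠ I) = s := Finset.filter_true_of_mem hsI
    by_cases hIs : pred I ⊆ s
    · have hfib : (reducedStrategies act pred (insert I 𝓘)).filter
          (fun r => r.filter (fun m => m.1 ≠ I) = s) =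
          (act I).image fun a => insert (I, a) s := by
        ext r
        simp only [Finset.mem_filter, Finset.mem_image]
        constructor
        · rintro ⟨hr, hrs⟩
          obtain ⟨h1, h2⟩ := mem_reducedStrategies.1 hr
          have hIr : pred I ⊆ r := hIs.trans (hrs ▸ Finset.filter_subset _ _)
          obtain ⟨a, ha, hu⟩ := (h2 I (Finset.mem_insert_self _ _)).1 hIr
          refine ⟨a, (h1 _ ha).2, ?_⟩
          rw [← hrs]
          ext ⟨J, b⟩
          simp only [Finset.mem_insert, Finset.mem_filter]
          constructor
          · rintro (h | h)
            · rwa [h]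
            · exact h.1
          · intro h
            by_cases hJ : J = I
            · subst hJ
              left
              rw [hu b h]
            · exact Or.inr ⟨h, hJ⟩
        · rintro ⟨a, ha, rfl⟩
          refine ⟨insert_mem_reducedStrategies hI hpred hs ha hIs, ?_⟩
          rw [Finset.filter_insert, if_neg (by simp), hfs]
      have hni : ∀ a, (I, a) ∉ s := fun a ha => hsI _ ha rfl
      rw [hfib, Finset.sum_image]
      · simp_rw [Finset.prod_insert (hni _)]
        rw [← Finset.sum_mul, hβ I (Finset.mem_insert_self _ _), one_mul]
      · intro a _ b _ hab
        have : (I, a) ∈ insert (I, b) s := by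
          rw [← show insert (I, a) s = insert (I, b) s from hab]
          exact Finset.mem_insert_self _ _
        rcases Finset.mem_insert.1 this with h | h
        · exact (Prod.ext_iff.1 h).2
        · exact absurd h (hni a)
    · have hfib : (reducedStrategies act pred (insert I 𝓘)).filter
          (fun r => r.filter (fun m => m.1 ≠ I) = s) = {s} := by
        ext r
        simp only [Finset.mem_filter, Finset.mem_singleton]
        constructor
        · rintro ⟨hr, hrs⟩
          have h2 := (mem_reducedStrategies.1 hr).2 I (Finset.mem_insert_self _ _)
          rw [← hrs, eq_comm, Finset.filter_eq_self]
          rintro ⟨J, b⟩ hm rfl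
          refine hIs fun m hm' => ?_
          rw [← hrs, Finset.mem_filter]
          exact ⟨h2.2 b hm hm', hpred _ (Finset.mem_insert_self _ _) m hm'⟩
        · rintro rfl
          exact ⟨mem_reducedStrategies_insert_of_not_subset hI hs hIs, hfs⟩
      rw [hfib, Finset.sum_singleton]

/-- The reduced strategies that contain a set `w` of moves have total weight `∏ m ∈ w, β m`, if `w`
is closed under predecessors and consistent. -/
theorem sum_prod_reducedStrategies_superset (rank : ι → ℕ) (β : ι × α → ℝ)
    (hrank : ∀ I ∈ 𝓘, ∀ m ∈ pred I, rank m.1 < rank I)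
    (hβ : ∀ I ∈ 𝓘, ∑ a ∈ act I, β (I, a) = 1) {w : Finset (ι × α)}
    (hw : ∀ m ∈ w, m.1 ∈ 𝓘 ∧ m.2 ∈ act m.1 ∧ pred m.1 ⊆ w)
    (hfun : ∀ m ∈ w, ∀ m' ∈ w, m.1 = m'.1 → m = m') :
    ∑ s ∈ reducedStrategies act pred 𝓘 with w ⊆ s, ∏ m ∈ s, β m = ∏ m ∈ w, β m := by
  -- the behaviour `β`, made deterministic along `w`
  set β' : ι × α → ℝ := fun m =>
    if m ∈ w then 1 else if ∃ m' ∈ w, m'.1 = m.1 then 0 else β m with hβ'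
  have hsum : ∀ I ∈ 𝓘, ∑ a ∈ act I, β' (I, a) = 1 := by
    intro I hI
    by_cases h : ∃ m' ∈ w, m'.1 = I
    · obtain ⟨⟨J, b⟩, hm, rfl⟩ := h
      rw [Finset.sum_eq_single_of_mem b (hw _ hm).2.1]
      · simp [hβ', hm]
      · intro a _ hab
        have : (J, a) ∉ w := fun ha => hab (Prod.ext_iff.1 (hfun _ ha _ hm rfl)).2
        simp only [hβ', if_neg this]
        exact if_pos ⟨_, hm, rfl⟩
    · rw [← hβ I hI]
      refine Finset.sum_congr rfl fun a _ => ?_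
      have : (I, a) ∉ w := fun ha => h ⟨_, ha, rfl⟩
      simp only [hβ', if_neg this, if_neg h]
  have key := sum_prod_reducedStrategies rank β' hrank hsum
  rw [← mul_one (∏ m ∈ w, β m), ← key, Finset.mul_sum, Finset.sum_filter]
  refine Finset.sum_congr rfl fun s hs => ?_
  rw [mem_reducedStrategies] at hs
  split_ifs with hws
  · have hone : ∏ m ∈ w, β' m = 1 := Finset.prod_eq_one fun m hm => if_pos hm
    rw [← Finset.prod_sdiff hws (f := β), ← Finset.prod_sdiff hws (f := β'), hone, mul_one,
      mul_comm]
    congr 1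
    refine Finset.prod_congr rfl fun m hm => ?_
    rw [Finset.mem_sdiff] at hm
    simp only [hβ', if_neg hm.2]
    rw [if_neg]
    rintro ⟨m', hm', h⟩
    have hmem := hs.1 m hm.1
    have hu := (hs.2 m.1 hmem.1)
    obtain ⟨a, _, ha⟩ := hu.1 (hu.2 m.2 hm.1)
    have h1 := ha m.2 hm.1
    have h2 := ha m'.2 (h ▸ hws hm')
    exact hm.2 ((Prod.ext h (h2.trans h1.symm) : m' = m) ▸ hm')
  · -- a move of `w` of least rank missing from `s` is replaced in `s` by one of weight zero
    obtain ⟨m, hm, hmin⟩ := (w \ s).exists_min_image (fun m => rank m.1)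
      (Finset.sdiff_nonempty.2 hws)
    rw [Finset.mem_sdiff] at hm
    have hmw := hw m hm.1
    have hpre : pred m.1 ⊆ s := by
      intro m' hm'
      by_contra hcon
      exact absurd (hmin m' (Finset.mem_sdiff.2 ⟨hmw.2.2 hm', hcon⟩))
        (not_le.2 (hrank _ hmw.1 m' hm'))
    obtain ⟨a, ha, -⟩ := (hs.2 m.1 hmw.1).1 hpre
    have haw : (m.1, a) ∉ w := fun h => hm.2 (hfun _ h _ hm.1 rfl ▸ ha)
    rw [Finset.prod_eq_zero ha, mul_zero]
    simp only [hβ', if_neg haw]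
    exact if_pos ⟨m, hm.1, rfl⟩

end Kuhn

/-! ### Histories and sequences under perfect recall -/

section Histories

variable {N : Type u} {A : Type v}

namespace ExtensiveGame

variable {G : ExtensiveGame N A}

lemma mem_act {h : List A} {a : A} : a ∈ G.act h ↔ h ++ [a] ∈ G.H := by
  simp only [act, actionsAfter, Finset.mem_filter, Finset.mem_biUnion, List.mem_toFinset,
    and_iff_right_iff_imp]
  exact fun hm => ⟨_, hm, by simp⟩

lemma mem_decisionNodes {i : Option N} {h : List A} :
    h ∈ decisionNodes G.H G.P i ↔ h ∈ G.H ∧ (G.act h).Nonempty ∧ G.P h = i := by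
  simp [decisionNodes, act]

lemma mem_decisionNodes_of_concat {h : List A} {a : A} (ha : h ++ [a] ∈ G.H) :
    h ∈ decisionNodes G.H G.P (G.P h) :=
  mem_decisionNodes.2 ⟨G.prefix_mem h a ha, ⟨a, mem_act.2 ha⟩, rfl⟩

lemma infoOf_mem_infoSets {i : Option N} {h : List A} (hh : h ∈ decisionNodes G.H G.P i) :
    G.infoOf h ∈ G.infoSets i := by
  obtain rfl := (mem_decisionNodes.1 hh).2.2
  exact (Finpartition.part_mem _).2 hh

lemma mem_infoOf {i : Option N} {h : List A} (hh : h ∈ decisionNodes G.H G.P i) :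
    h ∈ G.infoOf h := by
  obtain rfl := (mem_decisionNodes.1 hh).2.2
  exact (Finpartition.mem_part_self _).2 hh

lemma mem_decisionNodes_of_mem_infoSets {i : Option N} {I : Finset (List A)}
    (hI : I ∈ G.infoSets i) {h : List A} (hh : h ∈ I) : h ∈ decisionNodes G.H G.P i :=
  Finpartition.subset _ hI hh

lemma infoOf_eq {i : Option N} {I : Finset (List A)} (hI : I ∈ G.infoSets i) {h : List A}
    (hh : h ∈ I) : G.infoOf h = I := by
  obtain rfl := (mem_decisionNodes.1 (mem_decisionNodes_of_mem_infoSets hI hh)).2.2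
  exact Finpartition.part_eq_of_mem _ hI hh

lemma nonempty_of_mem_infoSets {i : Option N} {I : Finset (List A)} (hI : I ∈ G.infoSets i) :
    I.Nonempty :=
  Finpartition.nonempty_of_mem_parts _ hI

lemma actInfo_eq {i : Option N} {I : Finset (List A)} (hI : I ∈ G.infoSets i) {h : List A}
    (hh : h ∈ I) : G.actInfo I = G.act h := by
  refine Finset.Subset.antisymm (fun a ha => ?_) (Finset.subset_biUnion_of_mem G.act hh)
  obtain ⟨k, hk, ha⟩ := Finset.mem_biUnion.1 ha
  have := G.info_actions i I hI k hk h hh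
  exact (show G.act k = G.act h from this) ▸ ha

lemma experience_nil (i : Option N) : G.experience i [] = [] := by
  simp [experience]

lemma experience_eq_filterMap (i : Option N) (h : List A) :
    G.experience i h = (List.range h.length).filterMap fun q =>
      if G.P (h.take q) = i then h[q]?.map fun a => (G.infoOf (h.take q), a) else none := by
  have : List.range h.length = (List.finRange h.length).map Fin.val := by simp
  rw [this, List.filterMap_map, experience, ← List.filterMap_eq_map, List.filterMap_filter]
  congr 1
  funext q
  by_cases hq : G.P (h.take q) = i <;> simp [hq, moveAt]

lemma experience_concat (i : Option N) (h : List A) (a : A) :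
    G.experience i (h ++ [a]) =
      G.experience i h ++ if G.P h = i then [(G.infoOf h, a)] else [] := by
  rw [experience_eq_filterMap, experience_eq_filterMap, List.length_append, List.length_singleton,
    List.range_succ, List.filterMap_append]
  congr 1
  · refine List.filterMap_congr fun q hq => ?_
    have hq : q < h.length := List.mem_range.1 hq
    rw [List.take_append_of_le_length hq.le, List.getElem?_append_left hq]
  · by_cases hP : G.P h = i <;> simp [hP]

lemma seqOf_nil (i : Option N) : G.seqOf i [] = ∅ := by
  simp [seqOf, experience_nil]

lemma seqOf_concat (i : Option N) (h : List A) (a : A) :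
    G.seqOf i (h ++ [a]) =
      if G.P h = i then insert (G.infoOf h, a) (G.seqOf i h) else G.seqOf i h := by
  rw [seqOf, experience_concat, List.toFinset_append, seqOf]
  split_ifs
  · ext m
    simp [or_comm]
  · simp

lemma seqOf_mem_seqs (i : Option N) {h : List A} (hh : h ∈ G.H) : G.seqOf i h ∈ G.seqs i :=
  Finset.mem_image_of_mem _ hh

/-- Chance has perfect recall as well, because its information sets are singletons. -/
lemma PerfectRecall.experience_eq (hG : G.PerfectRecall) {i : Option N} {I : Finset (List A)}
    (hI : I ∈ G.infoSets i) {h k : List A} (hh : h ∈ I) (hk : k ∈ I) :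
    G.experience i h = G.experience i k := by
  cases i with
  | none =>
    obtain ⟨l, rfl⟩ := G.info_chance I hI
    rw [Finset.mem_singleton.1 hh, Finset.mem_singleton.1 hk]
  | some i => exact hG i I hI h hh k hk

lemma PerfectRecall.seqInfo_eq (hG : G.PerfectRecall) {i : Option N} {I : Finset (List A)}
    (hI : I ∈ G.infoSets i) {h : List A} (hh : h ∈ I) : G.seqInfo i I = G.seqOf i h := by
  refine Finset.Subset.antisymm (fun m hm => ?_) (Finset.subset_biUnion_of_mem (G.seqOf i) hh)
  obtain ⟨k, hk, hm⟩ := Finset.mem_biUnion.1 hm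
  rwa [seqOf, hG.experience_eq hI hh hk]

lemma PerfectRecall.seqExt_eq (hG : G.PerfectRecall) {i : Option N} {I : Finset (List A)}
    (hI : I ∈ G.infoSets i) {h : List A} (hh : h ∈ I) (a : A) :
    G.seqExt i I a = G.seqOf i (h ++ [a]) := by
  have hP := (mem_decisionNodes.1 (mem_decisionNodes_of_mem_infoSets hI hh)).2.2
  rw [seqExt, hG.seqInfo_eq hI hh, seqOf_concat, if_pos hP, infoOf_eq hI hh]

lemma PerfectRecall.seqInfo_mem_seqs (hG : G.PerfectRecall) {i : Option N} {I : Finset (List A)}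
    (hI : I ∈ G.infoSets i) : G.seqInfo i I ∈ G.seqs i := by
  obtain ⟨h, hh⟩ := nonempty_of_mem_infoSets hI
  rw [hG.seqInfo_eq hI hh]
  exact seqOf_mem_seqs _ (mem_decisionNodes.1 (mem_decisionNodes_of_mem_infoSets hI hh)).1

lemma PerfectRecall.seqExt_mem_seqs (hG : G.PerfectRecall) {i : Option N} {I : Finset (List A)}
    (hI : I ∈ G.infoSets i) {a : A} (ha : a ∈ G.actInfo I) : G.seqExt i I a ∈ G.seqs i := by
  obtain ⟨h, hh⟩ := nonempty_of_mem_infoSets hI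
  rw [hG.seqExt_eq hI hh]
  exact seqOf_mem_seqs _ (mem_act.1 (actInfo_eq hI hh ▸ ha))

/-- A move in `seqOf i h` is made at some prefix `k` of `h`; what is used of this is that the sequence
after the move is part of `seqOf i h`, and that the experience at `k` is a shorter list. -/
lemma exists_of_mem_seqOf {i : Option N} {h : List A} (hh : h ∈ G.H) {m : Move A}
    (hm : m ∈ G.seqOf i h) :
    m.1 ∈ G.infoSets i ∧ ∃ k ∈ m.1, m.2 ∈ G.act k ∧ G.seqOf i (k ++ [m.2]) ⊆ G.seqOf i h ∧
      (G.experience i k).length < (G.experience i h).length := by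
  induction h using List.reverseRecOn with
  | nil => simp [seqOf_nil] at hm
  | append_singleton h a ih =>
    have hd := mem_decisionNodes_of_concat hh
    by_cases hP : G.P h = i
    · have hm' := hm
      rw [seqOf_concat, if_pos hP, Finset.mem_insert] at hm
      rcases hm with rfl | hm
      · refine ⟨infoOf_mem_infoSets (hP ▸ hd), h, mem_infoOf hd, mem_act.2 hh, subset_rfl, ?_⟩
        simp [experience_concat, hP]
      · obtain ⟨h1, k, hk, hact, hsub, hlen⟩ := ih (G.prefix_mem h a hh) hm
        refine ⟨h1, k, hk, hact, ?_, ?_⟩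
        · rw [seqOf_concat i h, if_pos hP]
          exact hsub.trans (Finset.subset_insert _ _)
        · simp only [experience_concat, hP, if_true, List.length_append, List.length_singleton]
          omega
    · rw [seqOf_concat, if_neg hP] at hm
      rw [seqOf_concat i h, if_neg hP, experience_concat, if_neg hP, List.append_nil]
      exact ih (G.prefix_mem h a hh) hm

/-- No information set is visited twice along a history. -/
lemma PerfectRecall.notMem_seqInfo (hG : G.PerfectRecall) {i : Option N} {I : Finset (List A)}
    (hI : I ∈ G.infoSets i) (a : A) : (I, a) ∉ G.seqInfo i I := by
  obtain ⟨h, hh⟩ := nonempty_of_mem_infoSets hI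
  rw [hG.seqInfo_eq hI hh]
  intro hm
  obtain ⟨-, k, hk, -, -, hlen⟩ := exists_of_mem_seqOf
    (mem_decisionNodes.1 (mem_decisionNodes_of_mem_infoSets hI hh)).1 hm
  rw [hG.experience_eq hI hh hk] at hlen
  exact lt_irrefl _ hlen

lemma PerfectRecall.seqExt_subset_seqOf (hG : G.PerfectRecall) {i : Option N} {h : List A}
    (hh : h ∈ G.H) {m : Move A} (hm : m ∈ G.seqOf i h) :
    m.1 ∈ G.infoSets i ∧ m.2 ∈ G.actInfo m.1 ∧ G.seqExt i m.1 m.2 ⊆ G.seqOf i h := by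
  obtain ⟨h1, k, hk, hact, hsub, -⟩ := exists_of_mem_seqOf hh hm
  exact ⟨h1, (actInfo_eq h1 hk).symm ▸ hact, (hG.seqExt_eq h1 hk m.2).symm ▸ hsub⟩

lemma seqInfo_subset_seqExt (i : Option N) (I : Finset (List A)) (a : A) :
    G.seqInfo i I ⊆ G.seqExt i I a :=
  Finset.subset_insert _ _

lemma mem_seqExt (i : Option N) (I : Finset (List A)) (a : A) : (I, a) ∈ G.seqExt i I a :=
  Finset.mem_insert_self _ _

lemma PerfectRecall.card_seqInfo_lt (hG : G.PerfectRecall) {i : Option N} {I : Finset (List A)}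
    (hI : I ∈ G.infoSets i) {m : Move A} (hm : m ∈ G.seqInfo i I) :
    (G.seqInfo i m.1).card < (G.seqInfo i I).card := by
  obtain ⟨h, hh⟩ := nonempty_of_mem_infoSets hI
  rw [hG.seqInfo_eq hI hh] at hm ⊢
  obtain ⟨h1, -, h2⟩ := hG.seqExt_subset_seqOf
    (mem_decisionNodes.1 (mem_decisionNodes_of_mem_infoSets hI hh)).1 hm
  refine lt_of_lt_of_le ?_ (Finset.card_le_card h2)
  rw [seqExt, Finset.card_insert_of_notMem (hG.notMem_seqInfo h1 _)]
  exact Nat.lt_succ_self _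

lemma PerfectRecall.seqExt_injective (hG : G.PerfectRecall) {i : Option N}
    {I J : Finset (List A)} (hI : I ∈ G.infoSets i) (hJ : J ∈ G.infoSets i) {a b : A}
    (h : G.seqExt i I a = G.seqExt i J b) : I = J ∧ a = b := by
  rw [← Prod.mk_inj]
  by_contra hne
  have h1 := Finset.mem_of_mem_insert_of_ne (h ▸ mem_seqExt i I a) hne
  have h2 := Finset.mem_of_mem_insert_of_ne (h ▸ mem_seqExt i J b) (Ne.symm hne)
  exact lt_asymm (hG.card_seqInfo_lt hJ h1) (hG.card_seqInfo_lt hI h2)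

lemma PerfectRecall.eq_of_mem_seqOf (hG : G.PerfectRecall) {i : Option N} {h : List A}
    (hh : h ∈ G.H) {m m' : Move A} (hm : m ∈ G.seqOf i h) (hm' : m' ∈ G.seqOf i h)
    (hmm' : m.1 = m'.1) : m = m' := by
  induction h using List.reverseRecOn with
  | nil => simp [seqOf_nil] at hm
  | append_singleton h a ih =>
    specialize ih (G.prefix_mem h a hh)
    rw [seqOf_concat] at hm hm'
    split_ifs at hm hm' with hP
    · have hd := hP ▸ mem_decisionNodes_of_concat hh
      have hno : ∀ m ∈ G.seqOf i h, m.1 ≠ G.infoOf h := by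
        rintro ⟨I, b⟩ hm rfl
        rw [← hG.seqInfo_eq (infoOf_mem_infoSets hd) (mem_infoOf hd)] at hm
        exact hG.notMem_seqInfo (infoOf_mem_infoSets hd) b hm
      rcases Finset.mem_insert.1 hm with rfl | hm <;> rcases Finset.mem_insert.1 hm' with rfl | hm'
      · rfl
      · exact absurd hmm'.symm (hno _ hm')
      · exact absurd hmm' (hno _ hm)
      · exact ih hm hm'
    · exact ih hm hm'

lemma PerfectRecall.exists_eq_seqExt (hG : G.PerfectRecall) {i : Option N} {h : List A}
    (hh : h ∈ G.H) (hne : G.seqOf i h ≠ ∅) :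
    ∃ I ∈ G.infoSets i, ∃ a ∈ G.actInfo I, G.seqOf i h = G.seqExt i I a := by
  induction h using List.reverseRecOn with
  | nil => exact absurd (seqOf_nil i) hne
  | append_singleton h a ih =>
    by_cases hP : G.P h = i
    · have hd := hP ▸ mem_decisionNodes_of_concat hh
      refine ⟨_, infoOf_mem_infoSets hd, a, ?_, ?_⟩
      · rw [actInfo_eq (infoOf_mem_infoSets hd) (mem_infoOf hd)]
        exact mem_act.2 hh
      · rw [hG.seqExt_eq (infoOf_mem_infoSets hd) (mem_infoOf hd)]
    · rw [seqOf_concat, if_neg hP] at hne ⊢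
      exact ih (G.prefix_mem h a hh) hne

lemma mem_pureStrategies {i : Option N} {s : Finset (Move A)} :
    s ∈ G.pureStrategies i ↔ (∀ m ∈ s, m.1 ∈ G.infoSets i ∧ m.2 ∈ G.actInfo m.1) ∧
      ∀ I ∈ G.infoSets i, (G.seqInfo i I ⊆ s → ∃! a : A, (I, a) ∈ s) ∧
        (∀ a : A, (I, a) ∈ s → G.seqInfo i I ⊆ s) := by
  simp only [pureStrategies, Finset.mem_filter, Finset.mem_powerset]
  refine and_congr_left fun _ => ⟨fun h m hm => ?_, fun h m hm => ?_⟩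
  · obtain ⟨I, hI, hm'⟩ := Finset.mem_biUnion.1 (h hm)
    obtain ⟨a, ha, rfl⟩ := Finset.mem_image.1 hm'
    exact ⟨hI, ha⟩
  · exact Finset.mem_biUnion.2 ⟨m.1, (h m hm).1, Finset.mem_image.2 ⟨m.2, (h m hm).2, rfl⟩⟩

lemma pureStrategies_eq (i : Option N) :
    G.pureStrategies i = reducedStrategies G.actInfo (G.seqInfo i) (G.infoSets i) := by
  ext s
  rw [mem_pureStrategies, mem_reducedStrategies]

theorem PerfectRecall.sum_prod_pureStrategies (hG : G.PerfectRecall) {i : Option N}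
    {β : Move A → ℝ} (hβ : ∀ I ∈ G.infoSets i, ∑ a ∈ G.actInfo I, β (I, a) = 1)
    {h : List A} (hh : h ∈ G.H) :
    ∑ s ∈ G.pureStrategies i with G.seqOf i h ⊆ s, ∏ m ∈ s, β m = ∏ m ∈ G.seqOf i h, β m := by
  have key := sum_prod_reducedStrategies_superset (pred := G.seqInfo i) (w := G.seqOf i h)
    (fun I => (G.seqInfo i I).card) β (fun I hI m hm => hG.card_seqInfo_lt hI hm) hβ
    (fun m hm => ?_) (fun m hm m' hm' => hG.eq_of_mem_seqOf hh hm hm')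
  · rw [← pureStrategies_eq] at key
    convert key
  · obtain ⟨h1, h2, h3⟩ := hG.seqExt_subset_seqOf hh hm
    exact ⟨h1, h2, (seqInfo_subset_seqExt _ _ _).trans h3⟩

end ExtensiveGame
end Histories

/-! ### Realization weights of players and chance -/

section Weights

variable {N : Type u} {A : Type v}

namespace ExtensiveGame

variable {G : ExtensiveGame N A}

/-- The local probabilities of a realization plan telescope along a history. -/
theorem PerfectRecall.prod_seqOf_div (hG : G.PerfectRecall) {i : Option N}
    {γ : Finset (Move A) → ℝ} (h0 : γ ∅ = 1) (hpos : ∀ w ∈ G.seqs i, 0 < γ w)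
    {h : List A} (hh : h ∈ G.H) :
    ∏ m ∈ G.seqOf i h, γ (G.seqExt i m.1 m.2) / γ (G.seqInfo i m.1) = γ (G.seqOf i h) := by
  induction h using List.reverseRecOn with
  | nil => simp [seqOf_nil, h0]
  | append_singleton h a ih =>
    have hh' := G.prefix_mem h a hh
    specialize ih hh'
    by_cases hP : G.P h = i
    · have hd := hP ▸ mem_decisionNodes_of_concat hh
      have hI := infoOf_mem_infoSets hd
      have hhI := mem_infoOf hd
      have hno := hG.notMem_seqInfo hI a
      rw [hG.seqInfo_eq hI hhI] at hno
      rw [seqOf_concat i h, if_pos hP, Finset.prod_insert hno, ih, hG.seqExt_eq hI hhI,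
        hG.seqInfo_eq hI hhI, seqOf_concat i h, if_pos hP,
        div_mul_cancel₀ _ (hpos _ (seqOf_mem_seqs i hh')).ne']
    · rw [seqOf_concat i h, if_neg hP, ih]

/-- The probability with which chance makes a move; the information sets of chance are singletons. -/
def chanceProb (G : ExtensiveGame N A) (m : Move A) : ℝ := ∑ h ∈ m.1, G.fc h m.2

lemma infoOf_chance {h : List A} (hh : h ∈ decisionNodes G.H G.P none) : G.infoOf h = {h} := by
  obtain ⟨k, hk⟩ := G.info_chance _ (infoOf_mem_infoSets hh)
  have := mem_infoOf hh
  rw [hk, Finset.mem_singleton] at this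
  rw [hk, this]

lemma chanceProb_infoOf {h : List A} (hh : h ∈ decisionNodes G.H G.P none) (a : A) :
    G.chanceProb (G.infoOf h, a) = G.fc h a := by
  simp [chanceProb, infoOf_chance hh]

lemma exists_eq_infoOf_chance {I : Finset (List A)} (hI : I ∈ G.infoSets none) :
    ∃ h ∈ decisionNodes G.H G.P none, I = G.infoOf h := by
  obtain ⟨h, hh⟩ := nonempty_of_mem_infoSets hI
  exact ⟨h, mem_decisionNodes_of_mem_infoSets hI hh, (infoOf_eq hI hh).symm⟩

lemma sum_chanceProb {I : Finset (List A)} (hI : I ∈ G.infoSets none) :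
    ∑ a ∈ G.actInfo I, G.chanceProb (I, a) = 1 := by
  obtain ⟨h, hh, rfl⟩ := exists_eq_infoOf_chance hI
  simp_rw [chanceProb_infoOf hh, actInfo_eq hI (mem_infoOf hh)]
  exact G.fc_sum h hh

lemma PerfectRecall.chanceMixed_eq (hG : G.PerfectRecall) (s : G.PureStrategy none) :
    G.chanceMixed s = ∏ m ∈ s.1, G.chanceProb m := by
  obtain ⟨s, hs⟩ := s
  rw [mem_pureStrategies] at hs
  have hex : ∀ h ∈ (decisionNodes G.H G.P none).filter (fun h => G.seqOf none h ⊆ s),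
      ∃! a, (G.infoOf h, a) ∈ s := by
    intro h hh
    rw [Finset.mem_filter] at hh
    have hI := infoOf_mem_infoSets hh.1
    exact (hs.2 _ hI).1 ((hG.seqInfo_eq hI (mem_infoOf hh.1)).symm ▸ hh.2)
  choose! f hf hfu using hex
  unfold chanceMixed
  refine Finset.prod_bij (fun h hh => (G.infoOf h, f h hh)) (fun h hh => hf h hh) ?_ ?_ ?_
  · intro h hh k hk hhk
    have := (Prod.ext_iff.1 hhk).1
    simp only [infoOf_chance (Finset.mem_filter.1 hh).1,
      infoOf_chance (Finset.mem_filter.1 hk).1, Finset.singleton_inj] at this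
    exact this
  · rintro ⟨I, a⟩ hm
    have hI := (hs.1 _ hm).1
    obtain ⟨h, hh, rfl⟩ := exists_eq_infoOf_chance hI
    have hh' : h ∈ (decisionNodes G.H G.P none).filter (fun h => G.seqOf none h ⊆ s) :=
      Finset.mem_filter.2 ⟨hh, hG.seqInfo_eq hI (mem_infoOf hh) ▸ (hs.2 _ hI).2 a hm⟩
    exact ⟨h, hh', Prod.ext rfl (hfu h hh' a hm).symm⟩
  · intro h hh
    have hd := (Finset.mem_filter.1 hh).1
    have hI := infoOf_mem_infoSets hd
    have hmem := hf h hh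
    rw [chanceProb_infoOf hd, Finset.sum_eq_single_of_mem (f h hh)]
    · exact if_pos hmem
    · exact actInfo_eq hI (mem_infoOf hd) ▸ (hs.1 _ hmem).2
    · intro b _ hb
      exact if_neg fun h' => hb (hfu h hh b h')

lemma PerfectRecall.chancePlan_seqOf (hG : G.PerfectRecall) {h : List A} (hh : h ∈ G.H) :
    G.chancePlan (G.seqOf none h) = ∏ m ∈ G.seqOf none h, G.chanceProb m := by
  unfold chancePlan
  rw [Finset.prod_sigma', Finset.prod_ite, Finset.prod_const_one, mul_one]
  refine Finset.prod_bij (fun x _ => (G.infoOf x.1, x.2)) (fun x hx => (Finset.mem_filter.1 hx).2)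
    ?_ ?_ ?_
  · rintro ⟨k, a⟩ hk ⟨l, b⟩ hl hkl
    rw [Finset.mem_filter, Finset.mem_sigma] at hk hl
    simp only [infoOf_chance hk.1.1, infoOf_chance hl.1.1, Prod.mk_inj,
      Finset.singleton_inj] at hkl
    rw [hkl.1, hkl.2]
  · rintro ⟨I, a⟩ hm
    obtain ⟨hI, ha, -⟩ := hG.seqExt_subset_seqOf hh hm
    obtain ⟨k, hk, rfl⟩ := exists_eq_infoOf_chance hI
    refine ⟨⟨k, a⟩, Finset.mem_filter.2 ⟨Finset.mem_sigma.2 ⟨hk, ?_⟩, hm⟩, rfl⟩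
    exact actInfo_eq hI (mem_infoOf hk) ▸ ha
  · intro x hx
    rw [Finset.mem_filter, Finset.mem_sigma] at hx
    exact (chanceProb_infoOf hx.1.1 _).symm

/-- Realization equivalence: the reduced strategies that allow the history `h` have, under `σ(y)`, the
total probability that `y` assigns to the sequence defined by `h`. -/
theorem PerfectRecall.sum_withChanceMixed (hG : G.PerfectRecall) {y : Plans N A}
    (hy : G.IsInteriorPlanProfile y) (q : Option N) {h : List A} (hh : h ∈ G.H) :
    ∑ s : G.PureStrategy q with G.seqOf q h ⊆ s.1, G.withChanceMixed (G.toMixed y) q s =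
      G.withChancePlan y q (G.seqOf q h) := by
  cases q with
  | none =>
    simp only [withChanceMixed, withChancePlan]
    rw [hG.chancePlan_seqOf hh, ← hG.sum_prod_pureStrategies (fun I hI => sum_chanceProb hI) hh,
      Finset.sum_filter, Finset.sum_filter, ← Finset.sum_coe_sort (G.pureStrategies none)]
    exact Finset.sum_congr rfl fun s _ => by rw [hG.chanceMixed_eq]
  | some i =>
    simp only [withChanceMixed, withChancePlan]
    obtain ⟨⟨h0, hflow⟩, -⟩ := hy.1 i
    rw [← hG.prod_seqOf_div h0 (hy.2 i) hh, ← hG.sum_prod_pureStrategies (fun I hI => ?_) hh,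
      Finset.sum_filter, Finset.sum_filter, ← Finset.sum_coe_sort (G.pureStrategies (some i))]
    · rfl
    · simp only
      rw [← Finset.sum_div, hflow I hI, div_self (hy.2 i _ (hG.seqInfo_mem_seqs hI)).ne']

theorem PerfectRecall.isTotallyMixed_toMixed (hG : G.PerfectRecall) {y : Plans N A}
    (hy : G.IsInteriorPlanProfile y) : G.IsTotallyMixed (G.toMixed y) := by
  have hpos : ∀ i s, 0 < G.toMixed y i s := fun i s => Finset.prod_pos fun m hm => by
    obtain ⟨hI, ha⟩ := (mem_pureStrategies.1 s.2).1 m hm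
    exact div_pos (hy.2 i _ (hG.seqExt_mem_seqs hI ha)) (hy.2 i _ (hG.seqInfo_mem_seqs hI))
  refine ⟨fun i => ⟨fun s => (hpos i s).le, ?_⟩, hpos⟩
  have := hG.sum_withChanceMixed hy (some i) G.nil_mem
  simp only [seqOf_nil, Finset.empty_subset, Finset.filter_true] at this
  exact this.trans (hy.1 i).1.1

theorem PerfectRecall.toMixed_le (hG : G.PerfectRecall) {y : Plans N A}
    (hy : G.IsInteriorPlanProfile y) {i : N} (s : G.PureStrategy (some i)) {h : List A}
    (hh : h ∈ G.H) (hs : G.seqOf (some i) h ⊆ s.1) :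
    G.toMixed y i s ≤ y i (G.seqOf (some i) h) := by
  refine le_trans ?_ (hG.sum_withChanceMixed hy (some i) hh).le
  exact Finset.single_le_sum (f := G.toMixed y i)
    (fun s _ => ((hG.isTotallyMixed_toMixed hy).2 i s).le)
    (Finset.mem_filter.2 ⟨Finset.mem_univ s, hs⟩)

end ExtensiveGame
end Weights

/-! ### Payoffs in the normal form and in the sequence form -/

section Payoffs

variable {N : Type u} {A : Type v}

namespace ExtensiveGame

variable {G : ExtensiveGame N A}

lemma mem_H_of_mem_Z {h : List A} (hh : h ∈ G.Z) : h ∈ G.H := (Finset.mem_filter.1 hh).1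

variable [Fintype N]

/-- The contribution of the terminal history `h` to the payoff of `i` when `i` plays towards `h` and
the others follow the realization plans `y`. -/
def outcomeValue (G : ExtensiveGame N A) (i : N) (y : Plans N A) (h : List A) : ℝ :=
  G.payoff i h * ∏ q ∈ Finset.univ.erase (some i), G.withChancePlan y q (G.seqOf q h)

/-- The realization plan of the pure strategy with graph `s`: the indicator of the sequences all of
whose moves `s` prescribes. -/
def purePlan (s : Finset (Move A)) (w : Finset (Move A)) : ℝ := if w ⊆ s then 1 else 0

lemma purePayoff_eq (i : N) (s : ∀ q : Option N, G.PureStrategy q) :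
    G.purePayoff i s = ∑ h ∈ G.Z, G.payoff i h * ∏ q, purePlan (s q).1 (G.seqOf q h) := by
  refine Finset.sum_congr rfl fun h _ => ?_
  congr 1
  simp only [purePlan, Finset.prod_ite_zero, Finset.prod_const_one, Finset.mem_univ, true_implies]
  refine if_congr ⟨fun H q m hm => ?_, fun H k => ?_⟩ rfl rfl
  · simp only [seqOf, experience, List.mem_toFinset, List.mem_map, List.mem_filter,
      List.mem_finRange, true_and, decide_eq_true_eq] at hm
    obtain ⟨k, rfl, rfl⟩ := hm
    exact H k
  · refine H _ ?_
    simp only [seqOf, experience, List.mem_toFinset, List.mem_map, List.mem_filter,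
      List.mem_finRange, true_and, decide_eq_true_eq]
    exact ⟨k, rfl, rfl⟩

theorem PerfectRecall.normalPayoff_toMixed (hG : G.PerfectRecall) {y : Plans N A}
    (hy : G.IsInteriorPlanProfile y) (i : N) (s : G.PureStrategy (some i)) :
    G.normalPayoff i s (G.toMixed y) =
      ∑ h ∈ G.Z, purePlan s.1 (G.seqOf (some i) h) * G.outcomeValue i y h := by
  -- the weights that fix the strategy of `i` to `s` and draw those of the others from `toMixed y`
  set τ : ∀ q : Option N, G.PureStrategy q → ℝ := fun q r =>
    if q = some i then (if r.1 = s.1 then 1 else 0) else G.withChanceMixed (G.toMixed y) q r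
    with hτ
  have hprod : ∀ r : ∀ q : Option N, G.PureStrategy q, ∏ q, τ q (r q) =
      if r (some i) = s then
        ∏ q ∈ Finset.univ.erase (some i), G.withChanceMixed (G.toMixed y) q (r q) else 0 := by
    intro r
    rw [← Finset.mul_prod_erase _ _ (Finset.mem_univ (some i)),
      Finset.prod_congr rfl fun q hq => if_neg (Finset.ne_of_mem_erase hq)]
    simp only [hτ, if_true, Subtype.coe_inj, ite_mul, one_mul, zero_mul]
  have hsum : ∀ h ∈ G.Z, ∏ q, ∑ r : G.PureStrategy q, purePlan r.1 (G.seqOf q h) * τ q r =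
      purePlan s.1 (G.seqOf (some i) h) *
        ∏ q ∈ Finset.univ.erase (some i), G.withChancePlan y q (G.seqOf q h) := by
    intro h hh
    rw [← Finset.mul_prod_erase _ _ (Finset.mem_univ (some i))]
    congr 1
    · rw [Finset.sum_eq_single_of_mem s (Finset.mem_univ s)]
      · simp [hτ]
      · intro r _ hr
        simp [hτ, Subtype.coe_injective.ne hr]
    · refine Finset.prod_congr rfl fun q hq => ?_
      rw [← hG.sum_withChanceMixed hy q (mem_H_of_mem_Z hh), Finset.sum_filter]
      refine Finset.sum_congr rfl fun r _ => ?_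
      simp only [hτ, if_neg (Finset.ne_of_mem_erase hq), purePlan, ite_mul, one_mul, zero_mul]
  calc G.normalPayoff i s (G.toMixed y)
      = ∑ r : ∀ q : Option N, G.PureStrategy q, ∑ h ∈ G.Z,
          G.payoff i h * ∏ q, (purePlan (r q).1 (G.seqOf q h) * τ q (r q)) := by
        unfold normalPayoff
        rw [Finset.sum_filter]
        refine Finset.sum_congr rfl fun r _ => ?_
        simp_rw [Finset.prod_mul_distrib, hprod, ← mul_assoc]
        rw [← Finset.sum_mul, ← purePayoff_eq, mul_ite, mul_zero]
    _ = _ := by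
        rw [Finset.sum_comm]
        refine Finset.sum_congr rfl fun h hh => ?_
        rw [← Finset.mul_sum, ← Fintype.piFinset_univ, ← Finset.prod_univ_sum (fun _ => Finset.univ)
          fun q (r : G.PureStrategy q) => purePlan r.1 (G.seqOf q h) * τ q r, hsum h hh, outcomeValue]
        ring

theorem seqExpected_eq (i : N) (w : Finset (Move A)) (y : Plans N A) :
    G.seqExpected i w y = ∑ h ∈ G.Z with G.seqOf (some i) h = w, G.outcomeValue i y h := by
  unfold seqExpected seqPayoff
  simp_rw [Finset.sum_mul]
  rw [Finset.sum_comm, Finset.sum_filter]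
  refine Finset.sum_congr rfl fun h hh => ?_
  simp_rw [ite_mul, zero_mul]
  rw [Finset.sum_ite_eq']
  refine if_congr ?_ rfl rfl
  simp only [Finset.mem_filter, Fintype.mem_piFinset, and_iff_right_iff_imp]
  exact fun _ q => seqOf_mem_seqs q (mem_H_of_mem_Z hh)

theorem PerfectRecall.objective_eq (hG : G.PerfectRecall) (i : N) (γ : Finset (Move A) → ℝ)
    (y : Plans N A) :
    G.objective i γ y = ∑ h ∈ G.Z with G.seqOf (some i) h ≠ ∅,
      γ (G.seqOf (some i) h) * G.outcomeValue i y h := by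
  unfold objective
  simp_rw [seqExpected_eq, Finset.mul_sum, Finset.sum_filter]
  rw [Finset.sum_sigma', Finset.sum_comm]
  refine Finset.sum_congr rfl fun h hh => ?_
  split_ifs with hne
  · obtain ⟨I, hI, a, ha, hIa⟩ := hG.exists_eq_seqExt (mem_H_of_mem_Z hh) hne
    rw [Finset.sum_eq_single_of_mem ⟨I, a⟩ (Finset.mem_sigma.2 ⟨hI, ha⟩)]
    · rw [if_pos hIa, hIa]
    · rintro ⟨J, b⟩ hJ hne
      rw [Finset.mem_sigma] at hJ
      refine if_neg fun hJb => hne ?_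
      obtain ⟨rfl, rfl⟩ := hG.seqExt_injective hI hJ.1 (hIa.symm.trans hJb)
      rfl
  · refine Finset.sum_eq_zero fun x _ => if_neg fun hx => ?_
    rw [not_not] at hne
    rw [hne] at hx
    exact absurd (hx ▸ mem_seqExt (some i) x.1 x.2) (Finset.notMem_empty _)

/-- The two payoffs differ only by the terminal histories along which `i` makes no move, and the terms
of these do not depend on the strategy of `i`. -/
theorem PerfectRecall.normalPayoff_sub (hG : G.PerfectRecall) {y : Plans N A}
    (hy : G.IsInteriorPlanProfile y) (i : N) (s s' : G.PureStrategy (some i)) :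
    G.normalPayoff i s' (G.toMixed y) - G.normalPayoff i s (G.toMixed y) =
      G.objective i (purePlan s'.1) y - G.objective i (purePlan s.1) y := by
  rw [hG.normalPayoff_toMixed hy, hG.normalPayoff_toMixed hy, hG.objective_eq, hG.objective_eq,
    ← Finset.sum_sub_distrib, ← Finset.sum_sub_distrib, Finset.sum_filter]
  refine Finset.sum_congr rfl fun h _ => ?_
  split_ifs with hne
  · rfl
  · rw [not_not] at hne
    simp [hne, purePlan]

end ExtensiveGame
end Payoffs

/-! ### Equilibria of the artificial game -/

section Equilibria

variable {N : Type u} {A : Type v}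

namespace ExtensiveGame

variable {G : ExtensiveGame N A}

lemma flowEquations_purePlan {i : Option N} (s : G.PureStrategy i) :
    G.FlowEquations i (purePlan s.1) := by
  refine ⟨if_pos (Finset.empty_subset _), fun I hI => ?_⟩
  obtain ⟨h1, h2⟩ := mem_pureStrategies.1 s.2
  have hext : ∀ a, G.seqExt i I a ⊆ s.1 ↔ (I, a) ∈ s.1 := fun a =>
    ⟨fun h => h (mem_seqExt i I a),
      fun h => Finset.insert_subset_iff.2 ⟨h, (h2 I hI).2 a h⟩⟩
  simp only [purePlan, hext]
  split_ifs with hs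
  · obtain ⟨a, ha, hu⟩ := (h2 I hI).1 hs
    rw [Finset.sum_eq_single_of_mem a (h1 _ ha).2 (fun b _ hb => if_neg fun hb' => hb (hu b hb')),
      if_pos ha]
  · exact Finset.sum_eq_zero fun a _ => if_neg fun ha => hs ((h2 I hI).2 a ha)

lemma purePlan_nonneg (s w : Finset (Move A)) : 0 ≤ purePlan s w := by
  unfold purePlan
  split_ifs <;> norm_num

theorem PerfectRecall.plan_mem_Icc (hG : G.PerfectRecall) {i : Option N}
    {γ : Finset (Move A) → ℝ} (hγ : G.IsPlan i γ) {h : List A} (hh : h ∈ G.H) :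
    γ (G.seqOf i h) ∈ Set.Icc (0 : ℝ) 1 := by
  induction h using List.reverseRecOn with
  | nil => simp [seqOf_nil, hγ.1.1]
  | append_singleton h a ih =>
    specialize ih (G.prefix_mem h a hh)
    by_cases hP : G.P h = i
    · have hd := hP ▸ mem_decisionNodes_of_concat hh
      have hI := infoOf_mem_infoSets hd
      have hhI := mem_infoOf hd
      have ha : a ∈ G.actInfo (G.infoOf h) := actInfo_eq hI hhI ▸ mem_act.2 hh
      rw [← hG.seqExt_eq hI hhI]
      refine ⟨hγ.2 _ hI a ha, le_trans ?_ ih.2⟩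
      rw [← hG.seqInfo_eq hI hhI, ← hγ.1.2 _ hI]
      exact Finset.single_le_sum (f := fun a => γ (G.seqExt i (G.infoOf h) a))
        (fun b hb => hγ.2 _ hI b hb) ha
    · rwa [seqOf_concat, if_neg hP]

lemma FlowEquations.add_mul_sub {i : Option N} {γ δ δ' : Finset (Move A) → ℝ}
    (hγ : G.FlowEquations i γ) (hδ : G.FlowEquations i δ) (hδ' : G.FlowEquations i δ') (c : ℝ) :
    G.FlowEquations i (fun w => γ w + c * (δ' w - δ w)) := by
  refine ⟨by simp [hγ.1, hδ.1, hδ'.1], fun I hI => ?_⟩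
  rw [Finset.sum_add_distrib, ← Finset.mul_sum, Finset.sum_sub_distrib, hγ.2 I hI, hδ.2 I hI,
    hδ'.2 I hI]

lemma isClosed_isMixed (G : ExtensiveGame N A) : IsClosed {σ : G.Mixed | G.IsMixed σ} := by
  simp only [IsMixed, Set.ofPred_forall, Set.ofPred_and]
  refine isClosed_iInter fun i => IsClosed.inter (isClosed_iInter fun s => ?_) ?_
  · exact isClosed_le continuous_const (by fun_prop)
  · exact isClosed_eq (by fun_prop) continuous_const

variable [Fintype N]

lemma objective_add_mul_sub (i : N) (γ δ δ' : Finset (Move A) → ℝ) (c : ℝ) (y : Plans N A) :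
    G.objective i (fun w => γ w + c * (δ' w - δ w)) y =
      G.objective i γ y + c * (G.objective i δ' y - G.objective i δ y) := by
  simp only [objective, ← Finset.sum_sub_distrib, Finset.mul_sum, ← Finset.sum_add_distrib]
  exact Finset.sum_congr rfl fun _ _ => Finset.sum_congr rfl fun _ _ => by ring

/-- An optimal realization plan vanishes at some move of each inferior pure strategy: otherwise weight
could be shifted from that strategy to a better one. -/
theorem exists_move_eq_zero {p0 γ : Plans N A} {t : ℝ} (hγ : G.IsArtificialNash p0 t γ) {i : N}
    {s s' : G.PureStrategy (some i)}
    (hlt : G.objective i (purePlan s.1) (mixWithPrior p0 γ t) <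
      G.objective i (purePlan s'.1) (mixWithPrior p0 γ t)) :
    ∃ m ∈ s.1, γ i (G.seqExt (some i) m.1 m.2) = 0 := by
  by_contra! hne
  have hpos : ∀ m ∈ s.1, 0 < γ i (G.seqExt (some i) m.1 m.2) := fun m hm =>
    lt_of_le_of_ne ((hγ.1 i).2 _ ((mem_pureStrategies.1 s.2).1 m hm).1 _
      ((mem_pureStrategies.1 s.2).1 m hm).2) (hne m hm).symm
  obtain ⟨c, hc, hcs⟩ : ∃ c : ℝ, 0 < c ∧ ∀ m ∈ s.1, c ≤ γ i (G.seqExt (some i) m.1 m.2) := by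
    rcases s.1.eq_empty_or_nonempty with h | h
    · exact ⟨1, one_pos, by simp [h]⟩
    · obtain ⟨m, hm, hmin⟩ := s.1.exists_min_image
        (fun m => γ i (G.seqExt (some i) m.1 m.2)) h
      exact ⟨_, hpos m hm, hmin⟩
  have hfeas : G.IsFeasible i
      (fun w => γ i w + c * (purePlan s'.1 w - purePlan s.1 w)) := by
    refine ⟨(hγ.1 i).1.add_mul_sub (flowEquations_purePlan s) (flowEquations_purePlan s') c,
      fun I hI a ha _ => ?_⟩
    have h1 := mul_nonneg hc.le (purePlan_nonneg s'.1 (G.seqExt (some i) I a))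
    have h2 : c * purePlan s.1 (G.seqExt (some i) I a) ≤ γ i (G.seqExt (some i) I a) := by
      unfold purePlan
      split_ifs with hs
      · rw [mul_one]
        exact hcs (I, a) (hs (mem_seqExt _ _ _))
      · rw [mul_zero]
        exact (hγ.1 i).2 I hI a ha
    linarith
  have := (hγ.2 i).2 _ hfeas
  rw [objective_add_mul_sub] at this
  nlinarith [mul_pos hc (sub_pos.2 hlt)]

theorem PerfectRecall.isEpsNormalFormPerfect_toMixed (hG : G.PerfectRecall) {p0 γ : Plans N A}
    (hp0 : G.IsPlanProfile p0) {t : ℝ} (ht : 0 < t) (hγ : G.IsArtificialNash p0 t γ)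
    (hy : G.IsInteriorPlanProfile (mixWithPrior p0 γ t)) :
    G.IsEpsNormalFormPerfect t (G.toMixed (mixWithPrior p0 γ t)) := by
  refine ⟨ht, hG.isTotallyMixed_toMixed hy, fun i s s' hlt => ?_⟩
  obtain ⟨⟨I, a⟩, hm, hzero⟩ := exists_move_eq_zero hγ (i := i) (s := s) (s' := s')
    (sub_pos.1 (hG.normalPayoff_sub hy i s s' ▸ sub_pos.2 hlt))
  obtain ⟨hmem, hred⟩ := mem_pureStrategies.1 s.2
  obtain ⟨hI, ha⟩ := hmem _ hm
  obtain ⟨w, hw, hwI⟩ := Finset.mem_image.1 (hG.seqExt_mem_seqs hI ha)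
  have hsub : G.seqOf (some i) w ⊆ s.1 :=
    hwI ▸ Finset.insert_subset_iff.2 ⟨hm, (hred I hI).2 a hm⟩
  have hp := (hG.plan_mem_Icc (hp0 i) hw).2
  calc G.toMixed (mixWithPrior p0 γ t) i s
      ≤ mixWithPrior p0 γ t i (G.seqOf (some i) w) := hG.toMixed_le hy s hw hsub
    _ = t * p0 i (G.seqOf (some i) w) := by
        rw [mixWithPrior, hwI, hzero, mul_zero, zero_add]
    _ ≤ t := mul_le_of_le_one_right ht.le hp

end ExtensiveGame
end Equilibria

end SeqForm

end

theorem theorem7 {N : Type*} {A : Type*} [Fintype N]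
    (G : SeqForm.ExtensiveGame N A) (hG : G.PerfectRecall)
    (p0 : SeqForm.Plans N A) (hp0 : G.IsPlanProfile p0)
    (t : ℕ → ℝ) (ht : ∀ k, t k ∈ Set.Ioc (0 : ℝ) 1) (ht0 : Tendsto t atTop (𝓝 0))
    (γ : ℕ → SeqForm.Plans N A) (hγ : ∀ k, G.IsArtificialNash p0 (t k) (γ k))
    (hint : ∀ k, G.IsInteriorPlanProfile (SeqForm.mixWithPrior p0 (γ k) (t k)))
    (σ : G.Mixed)
    (hσ : MapClusterPt σ atTop
      (fun k => G.toMixed (SeqForm.mixWithPrior p0 (γ k) (t k)))) :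
    G.IsNormalFormPerfect σ := by
  have heps := fun k => hG.isEpsNormalFormPerfect_toMixed hp0 (ht k).1 (hγ k) (hint k)
  refine ⟨?_, t, _, ht0, heps, hσ⟩
  exact G.isClosed_isMixed.mem_of_mapClusterPt hσ (.of_forall fun k => (heps k).2.1.1)
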